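/- Let $n\ge 1$ be an integer. In the one-sided Gaussian contamination model with noise level $\sigma=1$ one observes $Y=(Y_1,\dots,Y_n)$ with $$Y_i=\theta+\mu_i+\xi_i,\qquad 1\le i\le n,$$ where $\xi_1,\dots,\xi_n$ are i.i.d. $\mathcal N(0,1)$, the minimum effect $\theta\in\mathbb R$ is unknown, and the unknown contamination vector $\mu$ belongs, for an integer $k\in[1,n-1]$, to $$\mathcal M_k=\Big\{\mu\in\mathbb R_+^n:\ \sum_{i=1}^n \mathbf 1_{\{\mu_i\neq 0\}}\le k\Big\}.$$ Write $\mathbb E_{\theta,\mu}$ for the expectation in this model, and define the $L_1$ minimax risk for the estimation of $\theta$ by $$\mathcal R[k,n]=\inf_{\widehat\theta}\ \sup_{(\theta,\mu)\in\mathbb R\times\mathcal M_k}\mathbb E_{\theta,\mu}\big[|\widehat\theta-\theta|\big]\in[0,\infty],$$ where the infimum is over all estimators, i.e. all measurable functions $\widehat\theta=\widehat\theta(Y)$ from $\mathbb R^n$ to $\mathbb R$. Theorem. There exists a universal constant $c>0$ such that for every positive integer $n$ and every integer $k\in[1,n-1]$, $$\mathcal R[k,n]\ \ge\ c\,\frac{\log^{2}\Big(1+\big(\tfrac{k}{n-k}\big)^{1/2}\Big)}{\log^{3/2}\Big(1+\big(\tfrac{k}{\sqrt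 n}\big)^{2/3}\Big)}.$$ -/

import Mathlib

open MeasureTheory ProbabilityTheory
open scoped ENNReal NNReal

noncomputable section

namespace GOSC

/-- The contamination vectors with at most `k` nonzero entries: all `μ ∈ ℝ₊ⁿ` such that
`∑ i, 1_{μ i ≠ 0} ≤ k`. -/
def contaminations (n k : ℕ) : Set (Fin n → ℝ) :=
  {μ | (∀ i, 0 ≤ μ i) ∧ (Finset.univ.filter fun i => μ i ≠ 0).card ≤ k}

/-- The law of the observation `Y` in the one-sided Gaussian contamination model with unit noise
level: `Y i = θ + μ i + ξ i` with `ξ i` i.i.d. standard normal, that is, the coordinates of `Y` are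
independent and `Y i` has law `𝒩(θ + μ i, 1)`. -/
def law {n : ℕ} (θ : ℝ) (μ : Fin n → ℝ) : Measure (Fin n → ℝ) :=
  Measure.pi fun i => gaussianReal (θ + μ i) 1

/-- The `L₁` risk `E_{θ,μ} |est(Y) - θ|` of an estimator `est` of the minimum effect `θ`, as an
element of `[0, ∞]`. -/
def risk {n : ℕ} (est : (Fin n → ℝ) → ℝ) (θ : ℝ) (μ : Fin n → ℝ) : ℝ≥0∞ :=
  ∫⁻ y, ENNReal.ofReal |est y - θ| ∂(law θ μ)

/-- The `L₁` minimax risk `R[k, n]`: the infimum, over all estimators (measurable functions of the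
observation), of the supremum of the risk over `θ ∈ ℝ` and over all contamination vectors with at
most `k` nonzero entries. -/
def minimaxRisk (k n : ℕ) : ℝ≥0∞ :=
  ⨅ (est : (Fin n → ℝ) → ℝ) (_ : Measurable est),
    ⨆ (θ : ℝ) (μ : Fin n → ℝ) (_ : μ ∈ contaminations n k), risk est θ μ

end GOSC

end

/-!
The proof compares two priors under which the observations are i.i.d. from Gaussian mixtures that
cannot be told apart from `n` draws, although the minimum effects are `0` and `Δ`.

*The priors.* Both mixing laws are finitely supported and come from one quadrature formula. Place
the `m + 1` extremal points of the Chebyshev polynomial `T_m` in an interval `[Δ, Δ + M]`, and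
write the value at `0` of a polynomial of degree at most `m` as a combination of its values at
these points. Since `0` lies outside the interval, the coefficients alternate in sign; since `T_m`
takes alternating values `±1` at its extremal points, the sum of their absolute values is the value
of `T_m` at the point corresponding to `0`, that is `cosh (m t)` with `Δ = M sinh (t / 2) ^ 2`
(`exists_chebyshev_extrapolation`). Splitting `δ_0` minus the combination into its positive and
negative parts gives, after normalization, two probability laws with the same moments up to order
`m`. The first charges `0`, and the second lives on `[Δ, ∞)` and charges `Δ`, with mass at least
`2 / (1 + cosh (m t))`. This is at least `1 - ε` when `m t = 2 log (1 + √(ε / (1 - ε)))`, so the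
separation `Δ` is of order `M log (1 + √(ε / (1 - ε))) ^ 2 / m ^ 2`.

*Indistinguishability.* The chi-square divergence of two Gaussian mixtures is controlled by a
quadratic form in the difference of the mixing weights, which expands into the squared moment
differences divided by factorials (`quadratic_form_le_of_moments_eq`). With `M` a small multiple of
`√m` it is at most `4 ε ^ 2 q ^ m` for a small constant `q`, and dividing by the lower bound `1 - ε`
on the first likelihood ratio gives the divergence, so that `m` of the order of
`log (n ε ^ 2 / (1 - ε))` makes it small compared with `1 / n`. Chi-square divergences tensorize,
which gives the bound in total variation (`setIntegral_prod_mixLR_sub_le`).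

*The number of contaminated coordinates.* It is binomial under the priors, and exceeds `k` with
small probability if `ε = k / (10 n)` (`fewOutliers_of_sparse`) or `1 - ε = 10 (n - k) / n`
(`fewOutliers_of_dense`). The first choice is made as long as `n - k` exceeds `n / 20`, the second
one otherwise. For `k ≤ √n` the claimed rate is `1 / √n`, and a translation of all observations
suffices (`ofReal_parametric_le_minimaxRisk`).
-/

namespace GOSC

/-! ### Gaussian likelihood ratios -/

/-- The likelihood ratio of `𝒩(a, 1)` with respect to `𝒩(0, 1)`. -/
noncomputable def gaussLR (a y : ℝ) : ℝ := Real.exp (a * y - a ^ 2 / 2)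

lemma gaussLR_pos (a y : ℝ) : 0 < gaussLR a y := Real.exp_pos _

lemma continuous_gaussLR (a : ℝ) : Continuous (gaussLR a) := by
  unfold gaussLR; fun_prop

lemma gaussLR_mul (a b y : ℝ) :
    gaussLR a y * gaussLR b y = Real.exp (-(a ^ 2 + b ^ 2) / 2) * Real.exp ((a + b) * y) := by
  unfold gaussLR
  rw [← Real.exp_add, ← Real.exp_add]; congr 1; ring

lemma integrable_gaussLR_mul (a b : ℝ) :
    Integrable (fun y => gaussLR a y * gaussLR b y) (gaussianReal 0 1) := by
  simp_rw [gaussLR_mul]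
  exact (integrable_exp_mul_gaussianReal _).const_mul _

lemma integral_gaussLR_mul (a b : ℝ) :
    ∫ y, gaussLR a y * gaussLR b y ∂(gaussianReal 0 1) = Real.exp (a * b) := by
  simp_rw [gaussLR_mul]
  rw [integral_const_mul]
  have h : ∫ y, Real.exp ((a + b) * y) ∂(gaussianReal 0 1) =
      mgf id (gaussianReal 0 1) (a + b) := rfl
  rw [h, mgf_id_gaussianReal, ← Real.exp_add]
  congr 1
  simp only [NNReal.coe_one]; ring

lemma gaussLR_zero (y : ℝ) : gaussLR 0 y = 1 := by simp [gaussLR]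

lemma integrable_gaussLR (a : ℝ) : Integrable (gaussLR a) (gaussianReal 0 1) := by
  simpa [gaussLR_zero] using integrable_gaussLR_mul a 0

lemma integral_gaussLR (a : ℝ) : ∫ y, gaussLR a y ∂(gaussianReal 0 1) = 1 := by
  simpa [gaussLR_zero] using integral_gaussLR_mul a 0

lemma gaussianReal_eq_withDensity_gaussLR (a : ℝ) :
    gaussianReal a 1 =
      (gaussianReal 0 1).withDensity fun y => ENNReal.ofReal (gaussLR a y) := by
  rw [gaussianReal_of_var_ne_zero _ one_ne_zero, gaussianReal_of_var_ne_zero _ one_ne_zero,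
    ← withDensity_mul _ (measurable_gaussianPDF 0 1)
      (continuous_gaussLR a).measurable.ennreal_ofReal]
  congr 1
  ext y
  simp only [Pi.mul_apply, gaussianPDF]
  rw [← ENNReal.ofReal_mul (gaussianPDFReal_nonneg _ _ _)]
  congr 1
  simp only [gaussianPDFReal, gaussLR]
  rw [mul_assoc _ (Real.exp _), ← Real.exp_add]
  congr 2
  simp only [NNReal.coe_one]; ring

lemma measureReal_gaussianReal_eq_integral (a : ℝ) {s : Set ℝ} (hs : MeasurableSet s) :
    (gaussianReal a 1).real s = ∫ y, s.indicator (gaussLR a) y ∂(gaussianReal 0 1) := by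
  rw [integral_indicator hs, measureReal_def, gaussianReal_eq_withDensity_gaussLR a,
    withDensity_apply _ hs,
    integral_eq_lintegral_of_nonneg_ae (ae_of_all _ fun y => (gaussLR_pos a y).le)
      (continuous_gaussLR a).aestronglyMeasurable]

/-- The standard Gaussian law on `ℝⁿ`, the reference measure for all likelihood ratios. -/
noncomputable abbrev stdLaw (n : ℕ) : Measure (Fin n → ℝ) := Measure.pi fun _ => gaussianReal 0 1

lemma pi_gaussianReal_eq_withDensity {n : ℕ} (z : Fin n → ℝ) :
    Measure.pi (fun i => gaussianReal (z i) 1) =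
      (stdLaw n).withDensity fun y => ENNReal.ofReal (∏ i, gaussLR (z i) (y i)) := by
  refine Measure.pi_eq fun s hs => ?_
  have hint : Integrable (fun y : Fin n → ℝ => ∏ i, gaussLR (z i) (y i)) (stdLaw n) :=
    Integrable.fintype_prod_dep fun i => integrable_gaussLR (z i)
  have hpos : ∀ y : Fin n → ℝ, 0 ≤ ∏ i, gaussLR (z i) (y i) := fun y =>
    Finset.prod_nonneg fun i _ => (gaussLR_pos _ _).le
  have hms : MeasurableSet (Set.univ.pi s) := MeasurableSet.univ_pi hs
  rw [withDensity_apply _ hms,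
    ← ofReal_integral_eq_lintegral_ofReal hint.integrableOn (ae_of_all _ hpos),
    ← integral_indicator hms]
  have hfun : (Set.univ.pi s).indicator (fun y : Fin n → ℝ => ∏ i, gaussLR (z i) (y i)) =
      fun y => ∏ i, (s i).indicator (gaussLR (z i)) (y i) := by
    ext y
    by_cases hy : y ∈ Set.univ.pi s
    · rw [Set.indicator_of_mem hy]
      exact Finset.prod_congr rfl fun i _ => (Set.indicator_of_mem (hy i trivial) _).symm
    · rw [Set.indicator_of_notMem hy]
      obtain ⟨i, hi⟩ : ∃ i, y i ∉ s i := by simpa [Set.mem_pi] using hy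
      exact (Finset.prod_eq_zero (Finset.mem_univ i) (Set.indicator_of_notMem hi _)).symm
  rw [hfun, integral_fintype_prod_eq_prod, ENNReal.ofReal_prod_of_nonneg]
  · refine Finset.prod_congr rfl fun i _ => ?_
    rw [← measureReal_gaussianReal_eq_integral _ (hs i), ofReal_measureReal]
  · intro i _
    exact integral_nonneg fun y => Set.indicator_nonneg (fun y _ => (gaussLR_pos _ _).le) y

lemma measureReal_pi_gaussianReal {n : ℕ} (z : Fin n → ℝ) {A : Set (Fin n → ℝ)}
    (hA : MeasurableSet A) :
    (Measure.pi fun i => gaussianReal (z i) 1).real A =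
      ∫ y in A, ∏ i, gaussLR (z i) (y i) ∂(stdLaw n) := by
  rw [measureReal_def, pi_gaussianReal_eq_withDensity, withDensity_apply _ hA,
    integral_eq_lintegral_of_nonneg_ae
      (ae_of_all _ fun y => Finset.prod_nonneg fun i _ => (gaussLR_pos _ _).le)]
  exact (Continuous.aestronglyMeasurable (by
    exact continuous_finsetProd _ fun i _ => (continuous_gaussLR _).comp (continuous_apply i)))

/-! ### Finite mixtures of Gaussian laws -/

section Mixture

variable {ι : Type*} [Fintype ι]

/-- The likelihood ratio with respect to `𝒩(0, 1)` of the mixture `∑ a, w a • 𝒩(x a, 1)`. -/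
noncomputable def mixLR (w x : ι → ℝ) (y : ℝ) : ℝ := ∑ a, w a * gaussLR (x a) y

lemma continuous_mixLR (w x : ι → ℝ) : Continuous (mixLR w x) :=
  continuous_finsetSum _ fun a _ => (continuous_gaussLR (x a)).const_mul (w a)

lemma integrable_mixLR (w x : ι → ℝ) : Integrable (mixLR w x) (gaussianReal 0 1) :=
  integrable_finsetSum _ fun a _ => (integrable_gaussLR (x a)).const_mul (w a)

lemma integral_mixLR (w x : ι → ℝ) : ∫ y, mixLR w x y ∂(gaussianReal 0 1) = ∑ a, w a := by
  unfold mixLR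
  rw [integral_finsetSum _ fun a _ => (integrable_gaussLR (x a)).const_mul (w a)]
  simp [integral_const_mul, integral_gaussLR]

lemma mixLR_sub (w v x : ι → ℝ) (y : ℝ) :
    mixLR w x y - mixLR v x y = mixLR (fun a => w a - v a) x y := by
  simp [mixLR, sub_mul, Finset.sum_sub_distrib]

lemma mixLR_sq (w x : ι → ℝ) (y : ℝ) :
    mixLR w x y ^ 2 = ∑ a, ∑ b, w a * w b * (gaussLR (x a) y * gaussLR (x b) y) := by
  rw [mixLR, sq, Finset.sum_mul_sum]
  exact Finset.sum_congr rfl fun a _ => Finset.sum_congr rfl fun b _ => by ring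

lemma integrable_mixLR_sq (w x : ι → ℝ) :
    Integrable (fun y => mixLR w x y ^ 2) (gaussianReal 0 1) := by
  simp_rw [mixLR_sq]
  exact integrable_finsetSum _ fun a _ => integrable_finsetSum _ fun b _ =>
    (integrable_gaussLR_mul _ _).const_mul _

/-- The squared `L²` norm of a mixture of Gaussian likelihood ratios is the quadratic form of the
weights with respect to the kernel `exp (x a * x b)`. -/
lemma integral_mixLR_sq (w x : ι → ℝ) :
    ∫ y, mixLR w x y ^ 2 ∂(gaussianReal 0 1) =
      ∑ a, ∑ b, w a * w b * Real.exp (x a * x b) := by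
  simp_rw [mixLR_sq]
  rw [integral_finsetSum _ fun a _ => integrable_finsetSum _ fun b _ =>
    (integrable_gaussLR_mul _ _).const_mul _]
  refine Finset.sum_congr rfl fun a _ => ?_
  rw [integral_finsetSum _ fun b _ => (integrable_gaussLR_mul _ _).const_mul _]
  exact Finset.sum_congr rfl fun b _ => by rw [integral_const_mul, integral_gaussLR_mul]

/-- The product of `n` copies of a mixture is the mixture, over all configurations
`c : Fin n → ι`, of the corresponding product laws. -/
lemma setIntegral_prod_mixLR {n : ℕ} (w x : ι → ℝ) {A : Set (Fin n → ℝ)}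
    (hA : MeasurableSet A) :
    ∫ y in A, ∏ i, mixLR w x (y i) ∂(stdLaw n) =
      ∑ c : Fin n → ι, (∏ i, w (c i)) *
        (Measure.pi fun i => gaussianReal (x (c i)) 1).real A := by
  classical
  have hexp : ∀ y : Fin n → ℝ, ∏ i, mixLR w x (y i) =
      ∑ c : Fin n → ι, (∏ i, w (c i)) * ∏ i, gaussLR (x (c i)) (y i) := fun y => by
    simp only [mixLR]
    rw [Finset.prod_univ_sum]
    simp [Finset.prod_mul_distrib, Fintype.piFinset_univ]
  simp_rw [hexp]
  rw [integral_finsetSum]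
  · exact Finset.sum_congr rfl fun c _ => by
      rw [integral_const_mul, measureReal_pi_gaussianReal _ hA]
  · intro c _
    exact ((Integrable.fintype_prod_dep (f := fun i => gaussLR (x (c i)))
      fun i => integrable_gaussLR _).const_mul _).integrableOn

/-- Two `n`-fold mixtures whose one-dimensional likelihood ratios are close in `L²` relative to
the lower bound `p` of the first are hard to tell apart: the total variation distance is
controlled by the chi-square divergence, which tensorizes. -/
lemma setIntegral_prod_mixLR_sub_le {n : ℕ} {w₀ w₁ x : ι → ℝ} {p : ℝ}
    (hs₀ : ∑ a, w₀ a = 1) (hs₁ : ∑ a, w₁ a = 1) (hp : 0 < p)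
    (hlb : ∀ y, p ≤ mixLR w₀ x y)
    (hχ : n * (∑ a, ∑ b, (w₁ a - w₀ a) * (w₁ b - w₀ b) * Real.exp (x a * x b)) ≤ p / 32)
    (A : Set (Fin n → ℝ)) :
    ∫ y in A, ∏ i, mixLR w₀ x (y i) ∂(stdLaw n) - ∫ y in A, ∏ i, mixLR w₁ x (y i) ∂(stdLaw n)
      ≤ 1 / 4 := by
  set χ := ∑ a, ∑ b, (w₁ a - w₀ a) * (w₁ b - w₀ b) * Real.exp (x a * x b) with hχdef
  have hpos : ∀ y, 0 < mixLR w₀ x y := fun y => hp.trans_le (hlb y)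
  set g : ℝ → ℝ := fun y => mixLR w₁ x y ^ 2 / mixLR w₀ x y with hg
  have hgint : Integrable g (gaussianReal 0 1) := by
    refine ((integrable_mixLR_sq w₁ x).div_const p).mono'
      ((((continuous_mixLR w₁ x).pow 2).div (continuous_mixLR w₀ x)
        fun y => (hpos y).ne').aestronglyMeasurable) (ae_of_all _ fun y => ?_)
    rw [Real.norm_of_nonneg (div_nonneg (sq_nonneg _) (hpos y).le)]
    exact div_le_div_of_nonneg_left (sq_nonneg _) hp (hlb y)
  have hgle : ∫ y, g y ∂(gaussianReal 0 1) ≤ 1 + χ / p := by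
    have hle : ∀ y, g y ≤ 2 * mixLR w₁ x y - mixLR w₀ x y +
        mixLR (fun a => w₁ a - w₀ a) x y ^ 2 / p := fun y => by
      have h1 : g y = 2 * mixLR w₁ x y - mixLR w₀ x y +
          mixLR (fun a => w₁ a - w₀ a) x y ^ 2 / mixLR w₀ x y := by
        rw [← mixLR_sub, hg]
        have := (hpos y).ne'
        field_simp
        ring
      rw [h1]
      gcongr
      exact hlb y
    have hi1 := (integrable_mixLR w₁ x).const_mul 2
    have hi2 := integrable_mixLR w₀ x
    have hi3 := (integrable_mixLR_sq (fun a => w₁ a - w₀ a) x).div_const p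
    refine (integral_mono hgint ((hi1.sub hi2).add hi3) hle).trans ?_
    rw [integral_add' (hi1.sub hi2) hi3, integral_sub' hi1 hi2, integral_const_mul, integral_div,
      integral_mixLR, integral_mixLR, integral_mixLR_sq, hs₀, hs₁]
    exact le_of_eq (by ring)
  have hg0 : 0 ≤ ∫ y, g y ∂(gaussianReal 0 1) :=
    integral_nonneg fun y => div_nonneg (sq_nonneg _) (hpos y).le
  have hpow : (∫ y, g y ∂(gaussianReal 0 1)) ^ n ≤ 1 + 1 / 16 := by
    have h1 : (∫ y, g y ∂(gaussianReal 0 1)) ≤ Real.exp (χ / p) := by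
      linarith [Real.add_one_le_exp (χ / p)]
    have h2 : n * (χ / p) ≤ 1 / 32 := by
      rw [← mul_div_assoc, div_le_iff₀ hp]; linarith
    calc _ ≤ Real.exp (χ / p) ^ n := pow_le_pow_left₀ hg0 h1 n
      _ = Real.exp (n * (χ / p)) := by rw [← Real.exp_nat_mul]
      _ ≤ Real.exp (1 / 32) := Real.exp_le_exp.2 h2
      _ ≤ 1 + 1 / 16 := by
        have := Real.exp_bound_div_one_sub_of_interval (x := 1 / 32) (by norm_num) (by norm_num)
        exact this.trans (by norm_num)
  set G₀ : (Fin n → ℝ) → ℝ := fun y => ∏ i, mixLR w₀ x (y i) with hG₀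
  set G₁ : (Fin n → ℝ) → ℝ := fun y => ∏ i, mixLR w₁ x (y i) with hG₁
  set H : (Fin n → ℝ) → ℝ := fun y => ∏ i, g (y i) with hH
  have iG₀ : Integrable G₀ (stdLaw n) := Integrable.fintype_prod fun _ => integrable_mixLR _ _
  have iG₁ : Integrable G₁ (stdLaw n) := Integrable.fintype_prod fun _ => integrable_mixLR _ _
  have iH : Integrable H (stdLaw n) := Integrable.fintype_prod fun _ => hgint
  have eG₀ : ∫ y, G₀ y ∂(stdLaw n) = 1 := by
    simp only [hG₀]; rw [integral_fintype_prod_eq_pow, integral_mixLR, hs₀, one_pow]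
  have eG₁ : ∫ y, G₁ y ∂(stdLaw n) = 1 := by
    simp only [hG₁]; rw [integral_fintype_prod_eq_pow, integral_mixLR, hs₁, one_pow]
  have eH : ∫ y, H y ∂(stdLaw n) ≤ 1 + 1 / 16 := by
    simp only [hH]
    rw [integral_fintype_prod_eq_pow]
    simpa using hpow
  have hG₀pos : ∀ y, 0 < G₀ y := fun y => Finset.prod_pos fun i _ => hpos _
  have hHdiv : ∀ y, H y = G₁ y ^ 2 / G₀ y := fun y => by
    simp only [hH, hG₀, hG₁, hg, Finset.prod_div_distrib, Finset.prod_pow]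
  -- The weight `4` balances the two terms of the arithmetic-geometric mean inequality.
  have hamgm : ∀ y, G₀ y - G₁ y ≤ 2 * (H y - 2 * G₁ y + G₀ y) + G₀ y / 8 := fun y => by
    have h2 : 2 * (H y - 2 * G₁ y + G₀ y) + G₀ y / 8 - (G₀ y - G₁ y) =
        (4 * (G₀ y - G₁ y) - G₀ y) ^ 2 / (8 * G₀ y) := by
      rw [hHdiv]
      have := (hG₀pos y).ne'
      field_simp
      ring
    have h3 : 0 ≤ (4 * (G₀ y - G₁ y) - G₀ y) ^ 2 / (8 * G₀ y) :=
      div_nonneg (sq_nonneg _) (by linarith [hG₀pos y])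
    linarith
  have hB0 : ∀ y, 0 ≤ 2 * (H y - 2 * G₁ y + G₀ y) + G₀ y / 8 := fun y => by
    have h2 : H y - 2 * G₁ y + G₀ y = (G₁ y - G₀ y) ^ 2 / G₀ y := by
      rw [hHdiv]
      have := (hG₀pos y).ne'
      field_simp
      ring
    rw [h2]
    have h3 := hG₀pos y
    positivity
  have iB : Integrable (fun y => 2 * (H y - 2 * G₁ y + G₀ y) + G₀ y / 8) (stdLaw n) :=
    (((iH.sub (iG₁.const_mul 2)).add iG₀).const_mul 2).add (iG₀.div_const 8)
  rw [← integral_sub iG₀.integrableOn iG₁.integrableOn]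
  calc ∫ y in A, (G₀ y - G₁ y) ∂(stdLaw n)
      ≤ ∫ y in A, (2 * (H y - 2 * G₁ y + G₀ y) + G₀ y / 8) ∂(stdLaw n) :=
        integral_mono (iG₀.sub iG₁).integrableOn iB.integrableOn hamgm
    _ ≤ ∫ y, (2 * (H y - 2 * G₁ y + G₀ y) + G₀ y / 8) ∂(stdLaw n) :=
        setIntegral_le_integral iB (ae_of_all _ hB0)
    _ = 2 * (∫ y, H y ∂(stdLaw n) - 2 * 1 + 1) + 1 / 8 := by
        have e1 : ∫ y, (H y - 2 * G₁ y) ∂(stdLaw n) = ∫ y, H y ∂(stdLaw n) - 2 * 1 := by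
          rw [integral_sub iH (iG₁.const_mul 2), integral_const_mul, eG₁]
        have e2 : ∫ y, (H y - 2 * G₁ y + G₀ y) ∂(stdLaw n) = ∫ y, H y ∂(stdLaw n) - 2 * 1 + 1 := by
          rw [← e1, ← eG₀]
          exact integral_add (iH.sub (iG₁.const_mul 2)) iG₀
        rw [← e2, ← integral_const_mul, ← eG₀, ← integral_div]
        exact integral_add (((iH.sub (iG₁.const_mul 2)).add iG₀).const_mul 2) (iG₀.div_const 8)
    _ ≤ 1 / 4 := by linarith

end Mixture

/-! ### From priors to the minimax risk -/

/-- If each of `n` independent draws differs from the distinguished value with probability at most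
`1 - p`, then more than `k` draws differ from it with probability at most `1 / 8`. The laws are
those with finite support, written as weight functions. -/
def FewOutliers (n k : ℕ) (p : ℝ) : Prop :=
  ∀ (ι : Type) [Fintype ι] [DecidableEq ι] (w : ι → ℝ) (a : ι),
    (∀ b, 0 ≤ w b) → ∑ b, w b = 1 → p ≤ w a →
      ∑ c : Fin n → ι with k < (Finset.univ.filter fun i => c i ≠ a).card, ∏ i, w (c i) ≤ 1 / 8

/-- Markov's inequality for the loss. -/
lemma measureReal_le_of_risk_le {n : ℕ} {est : (Fin n → ℝ) → ℝ} (hest : Measurable est)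
    {θ : ℝ} {μ : Fin n → ℝ} {B : ℝ≥0∞} (hB : B ≠ ∞) (hrisk : risk est θ μ ≤ B) {t : ℝ}
    (ht : 0 < t) {S : Set (Fin n → ℝ)} (hS : ∀ y ∈ S, t ≤ |est y - θ|) :
    (law θ μ).real S ≤ B.toReal / t := by
  have h1 : ENNReal.ofReal t * law θ μ S ≤ B := by
    have h2 : S ⊆ {y | ENNReal.ofReal t ≤ ENNReal.ofReal |est y - θ|} := fun y hy =>
      ENNReal.ofReal_le_ofReal (hS y hy)
    calc _ ≤ ENNReal.ofReal t * law θ μ {y | ENNReal.ofReal t ≤ ENNReal.ofReal |est y - θ|} := by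
          gcongr
      _ ≤ risk est θ μ := mul_meas_ge_le_lintegral (by fun_prop) _
      _ ≤ B := hrisk
  have h3 := ENNReal.toReal_mono hB h1
  rw [ENNReal.toReal_mul, ENNReal.toReal_ofReal ht.le] at h3
  rw [le_div_iff₀ ht, measureReal_def]
  linarith

lemma sum_mul_le_add_of_bad {κ : Type*} [Fintype κ] {W q : κ → ℝ} (bad : κ → Prop)
    [DecidablePred bad] {β η : ℝ} (hβ : 0 ≤ β) (hW : ∀ c, 0 ≤ W c) (hW1 : ∑ c, W c = 1)
    (hbad : ∑ c with bad c, W c ≤ η) (hq1 : ∀ c, q c ≤ 1)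
    (hq : ∀ c, W c ≠ 0 → ¬ bad c → q c ≤ β) :
    ∑ c, W c * q c ≤ β + η := by
  calc ∑ c, W c * q c ≤ ∑ c, (W c * β + if bad c then W c else 0) := by
        refine Finset.sum_le_sum fun c _ => ?_
        by_cases hc : bad c
        · rw [if_pos hc]
          nlinarith [hW c, hq1 c, mul_nonneg (hW c) hβ, mul_le_mul_of_nonneg_left (hq1 c) (hW c)]
        · rw [if_neg hc, add_zero]
          by_cases h0 : W c = 0
          · simp [h0]
          · exact mul_le_mul_of_nonneg_left (hq c h0 hc) (hW c)
    _ ≤ β + η := by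
        rw [Finset.sum_add_distrib, ← Finset.sum_mul, hW1, one_mul, ← Finset.sum_filter]
        linarith

/-- A pair of finitely supported priors gives a lower bound on the minimax risk. Under the first
one `θ = 0` and `μ` has i.i.d. coordinates of law `w₀`; under the second one `θ = Δ` and the
coordinates of `θ + μ` are i.i.d. of law `w₁`. Both priors charge vectors with more than `k`
nonzero entries, but with probability at most `1 / 8`. -/
theorem ofReal_le_minimaxRisk_of_priors {n k : ℕ} {ι : Type} [Fintype ι] [DecidableEq ι]
    {w₀ w₁ x : ι → ℝ} {p Δ : ℝ} {a₀ a₁ : ι} (hΔ : 0 < Δ) (hp : 0 < p)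
    (hw₀ : ∀ a, 0 ≤ w₀ a) (hw₁ : ∀ a, 0 ≤ w₁ a) (hs₀ : ∑ a, w₀ a = 1) (hs₁ : ∑ a, w₁ a = 1)
    (hx : ∀ a, 0 ≤ x a) (hxa₀ : x a₀ = 0) (hxa₁ : x a₁ = Δ)
    (hsupp : ∀ a, w₁ a ≠ 0 → Δ ≤ x a) (hp₀ : p ≤ w₀ a₀) (hp₁ : p ≤ w₁ a₁)
    (htail : FewOutliers n k p)
    (hχ : n * (∑ a, ∑ b, (w₁ a - w₀ a) * (w₁ b - w₀ b) * Real.exp (x a * x b)) ≤ p / 32) :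
    ENNReal.ofReal (Δ / 8) ≤ minimaxRisk k n := by
  unfold minimaxRisk
  refine le_iInf fun est => le_iInf fun hest => ?_
  set B : ℝ≥0∞ := ⨆ (θ : ℝ) (μ : Fin n → ℝ) (_ : μ ∈ contaminations n k), risk est θ μ with hBdef
  by_cases hB : B = ∞
  · rw [hB]; exact le_top
  have hrisk : ∀ θ, ∀ μ ∈ contaminations n k, risk est θ μ ≤ B := fun θ μ hμ =>
    le_iSup_of_le θ (le_iSup_of_le μ (le_iSup_of_le hμ le_rfl))
  have hΔ2 : 0 < Δ / 2 := by positivity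
  set β := B.toReal / (Δ / 2) with hβdef
  have hβ : 0 ≤ β := div_nonneg ENNReal.toReal_nonneg hΔ2.le
  set A : Set (Fin n → ℝ) := {y | est y < Δ / 2} with hAdef
  have hA : MeasurableSet A := measurableSet_lt hest measurable_const
  have hlb : ∀ y, p ≤ mixLR w₀ x y := fun y => by
    refine hp₀.trans ?_
    have : w₀ a₀ * gaussLR (x a₀) y ≤ mixLR w₀ x y :=
      Finset.single_le_sum (f := fun a => w₀ a * gaussLR (x a) y)
        (fun a _ => mul_nonneg (hw₀ a) (gaussLR_pos _ _).le) (Finset.mem_univ a₀)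
    rwa [hxa₀, gaussLR_zero, mul_one] at this
  have hsum1 : ∀ w : ι → ℝ, ∑ a, w a = 1 → ∑ c : Fin n → ι, ∏ i, w (c i) = 1 := fun w hw => by
    have := Finset.prod_univ_sum (fun _ : Fin n => (Finset.univ : Finset ι)) fun _ a => w a
    rw [Fintype.piFinset_univ] at this
    rw [← this]
    simp [hw]
  have hone : ∀ (z : Fin n → ℝ) (S : Set (Fin n → ℝ)),
      (Measure.pi fun i => gaussianReal (z i) 1).real S ≤ 1 := fun z S => measureReal_le_one
  -- Under the first prior an error means that the estimate is at least `Δ / 2`.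
  have h0 : ∫ y in Aᶜ, ∏ i, mixLR w₀ x (y i) ∂(stdLaw n) ≤ β + 1 / 8 := by
    rw [setIntegral_prod_mixLR _ _ hA.compl]
    refine sum_mul_le_add_of_bad
      (fun c : Fin n → ι => k < (Finset.univ.filter fun i => c i ≠ a₀).card) hβ
      (fun c => Finset.prod_nonneg fun i _ => hw₀ _) (hsum1 _ hs₀) (htail ι w₀ a₀ hw₀ hs₀ hp₀)
      (fun c => hone _ _) fun c _ hc => ?_
    have hμ : (fun i => x (c i)) ∈ contaminations n k := by
      refine ⟨fun i => hx _, le_trans (Finset.card_le_card fun i => ?_) (not_lt.1 hc)⟩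
      simp only [Finset.mem_filter, Finset.mem_univ, true_and]
      intro h h'
      exact h (by rw [h', hxa₀])
    have hl : (Measure.pi fun i => gaussianReal (x (c i)) 1) = law 0 fun i => x (c i) := by
      simp [law]
    rw [hl]
    refine measureReal_le_of_risk_le hest hB (hrisk _ _ hμ) hΔ2 fun y hy => ?_
    have hy' : Δ / 2 ≤ est y := not_lt.1 hy
    rw [sub_zero]
    exact hy'.trans (le_abs_self _)
  -- Under the second prior an error means that the estimate is below `Δ / 2`.
  have h1 : ∫ y in A, ∏ i, mixLR w₁ x (y i) ∂(stdLaw n) ≤ β + 1 / 8 := by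
    rw [setIntegral_prod_mixLR _ _ hA]
    refine sum_mul_le_add_of_bad
      (fun c : Fin n → ι => k < (Finset.univ.filter fun i => c i ≠ a₁).card) hβ
      (fun c => Finset.prod_nonneg fun i _ => hw₁ _) (hsum1 _ hs₁) (htail ι w₁ a₁ hw₁ hs₁ hp₁)
      (fun c => hone _ _) fun c hc0 hc => ?_
    have hμ : (fun i => x (c i) - Δ) ∈ contaminations n k := by
      refine ⟨fun i => ?_, le_trans (Finset.card_le_card fun i => ?_) (not_lt.1 hc)⟩
      · have := hsupp (c i) (Finset.prod_ne_zero_iff.1 hc0 i (Finset.mem_univ i))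
        linarith
      · simp only [Finset.mem_filter, Finset.mem_univ, true_and]
        intro h h'
        exact h (by rw [h', hxa₁, sub_self])
    have hl : (Measure.pi fun i => gaussianReal (x (c i)) 1) = law Δ fun i => x (c i) - Δ := by
      simp [law]
    rw [hl]
    refine measureReal_le_of_risk_le hest hB (hrisk _ _ hμ) hΔ2 fun y hy => ?_
    have hy' : est y < Δ / 2 := hy
    rw [abs_sub_comm]
    exact le_trans (by linarith) (le_abs_self _)
  have hG : Integrable (fun y : Fin n → ℝ => ∏ i, mixLR w₀ x (y i)) (stdLaw n) :=
    Integrable.fintype_prod fun _ => integrable_mixLR _ _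
  have hadd := integral_add_compl hA hG
  rw [integral_fintype_prod_eq_pow, integral_mixLR, hs₀, one_pow] at hadd
  have htv := setIntegral_prod_mixLR_sub_le hs₀ hs₁ hp hlb hχ A
  have hfin : 1 / 4 ≤ β := by linarith
  rw [hβdef, le_div_iff₀ hΔ2] at hfin
  rw [ENNReal.ofReal_le_iff_le_toReal hB]
  linarith

/-! ### The number of contaminated coordinates -/

/-- The exponential Markov inequality: the indicator of the bad event is dominated by a product of
functions of the coordinates. Here `u` is the factor of a coordinate equal to the distinguished
value and `v` that of any other coordinate. -/
lemma sum_prod_le_of_product_bound {n k : ℕ} {ι : Type} [Fintype ι] [DecidableEq ι] {w : ι → ℝ}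
    {a : ι} (hw : ∀ b, 0 ≤ w b) (hs : ∑ b, w b = 1) {u v K : ℝ} (hu : 0 ≤ u) (hv : 0 ≤ v)
    (hK : 0 ≤ K) (hb : ∀ j : ℕ, j ≤ n → k < j → 1 ≤ K * (u ^ (n - j) * v ^ j)) :
    ∑ c : Fin n → ι with k < (Finset.univ.filter fun i => c i ≠ a).card, ∏ i, w (c i) ≤
      K * (w a * u + (1 - w a) * v) ^ n := by
  have hpow : (w a * u + (1 - w a) * v) ^ n =
      ∑ c : Fin n → ι, ∏ i, (w (c i) * if c i ≠ a then v else u) := by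
    have := Finset.prod_univ_sum (fun _ : Fin n => (Finset.univ : Finset ι))
      fun _ b => w b * if b ≠ a then v else u
    rw [Fintype.piFinset_univ] at this
    rw [← this, Finset.prod_const, Finset.card_univ, Fintype.card_fin]
    congr 1
    rw [← Finset.add_sum_erase _ _ (Finset.mem_univ a), if_neg (by simp)]
    rw [← Finset.add_sum_erase _ _ (Finset.mem_univ a)] at hs
    congr 1
    rw [← hs, add_sub_cancel_left, Finset.sum_mul]
    exact Finset.sum_congr rfl fun b hb => by rw [if_pos (Finset.ne_of_mem_erase hb)]
  rw [hpow, Finset.mul_sum, Finset.sum_filter]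
  refine Finset.sum_le_sum fun c _ => ?_
  have h0 : 0 ≤ ∏ i, w (c i) := Finset.prod_nonneg fun i _ => hw _
  have hprod : ∏ i, (if c i ≠ a then v else u) =
      u ^ (n - (Finset.univ.filter fun i => c i ≠ a).card) *
        v ^ (Finset.univ.filter fun i => c i ≠ a).card := by
    rw [Finset.prod_ite, Finset.prod_const, Finset.prod_const, mul_comm]
    congr 2
    have := Finset.card_filter_add_card_filter_not (s := (Finset.univ : Finset (Fin n)))
      (fun i => c i ≠ a)
    rw [Finset.card_univ, Fintype.card_fin] at this
    omega
  rw [Finset.prod_mul_distrib, hprod]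
  split_ifs with h
  · have := hb _ ((Finset.card_le_univ _).trans (by simp)) h
    calc ∏ i, w (c i) = (∏ i, w (c i)) * 1 := (mul_one _).symm
      _ ≤ _ := by
        refine (mul_le_mul_of_nonneg_left this h0).trans (le_of_eq ?_)
        ring
  · positivity

/-- With contamination probability at most `k / (10 n)`, more than `k` contaminated coordinates are
unlikely. -/
lemma fewOutliers_of_sparse {n k : ℕ} (hk : 1 ≤ k) (hkn : k ≤ n) {p : ℝ}
    (hp : 1 - (k : ℝ) / (10 * n) ≤ p) : FewOutliers n k p := by
  intro ι _ _ w a hw hs hpa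
  have hn : (0 : ℝ) < n := by exact_mod_cast (by omega : 0 < n)
  have hk' : (1 : ℝ) ≤ k := by exact_mod_cast hk
  have hwa : w a ≤ 1 := hs ▸ Finset.single_le_sum (fun b _ => hw b) (Finset.mem_univ a)
  refine (sum_prod_le_of_product_bound (k := k) (a := a) hw hs (u := 1) (v := 6)
    (K := ((6 : ℝ) ^ (k + 1))⁻¹) zero_le_one (by norm_num) (by positivity) ?_).trans ?_
  · intro j _ hj
    rw [one_pow, one_mul, ← div_eq_inv_mul, one_le_div (by positivity)]
    exact pow_le_pow_right₀ (by norm_num) hj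
  · have h1 : w a * 1 + (1 - w a) * 6 ≤ Real.exp ((k : ℝ) / (2 * n)) := by
      have h2 : (k : ℝ) / (2 * n) = 5 * (k / (10 * n)) := by field_simp; norm_num
      have := Real.add_one_le_exp ((k : ℝ) / (2 * n))
      linarith
    have h3 : (w a * 1 + (1 - w a) * 6) ^ n ≤ 2 ^ k := by
      calc _ ≤ Real.exp ((k : ℝ) / (2 * n)) ^ n :=
            pow_le_pow_left₀ (by nlinarith [hw a]) h1 n
        _ = Real.exp (1 / 2) ^ k := by
            rw [← Real.exp_nat_mul, ← Real.exp_nat_mul]; congr 1; field_simp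
        _ ≤ 2 ^ k := by
            refine pow_le_pow_left₀ (Real.exp_pos _).le ?_ k
            exact (Real.exp_bound_div_one_sub_of_interval (by norm_num) (by norm_num)).trans
              (by norm_num)
    calc _ ≤ ((6 : ℝ) ^ (k + 1))⁻¹ * 2 ^ k := by gcongr
      _ = 1 / 6 * (1 / 3) ^ k := by
          rw [pow_succ, show (6 : ℝ) = 3 * 2 by norm_num, mul_pow, one_div_pow]
          field_simp
      _ ≤ 1 / 6 * (1 / 3) ^ 1 := by
          gcongr ?_ * ?_
          exact pow_le_pow_of_le_one (by norm_num) (by norm_num) hk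
      _ ≤ 1 / 8 := by norm_num

/-- With probability at least `10 (n - k) / n` of an uncontaminated coordinate, fewer than `n - k`
uncontaminated coordinates are unlikely. -/
lemma fewOutliers_of_dense {n k : ℕ} (hkn : k < n) {p : ℝ}
    (hp : 10 * ((n : ℝ) - k) / n ≤ p) : FewOutliers n k p := by
  intro ι _ _ w a hw hs hpa
  obtain ⟨L, rfl⟩ : ∃ L, n = k + (L + 1) := ⟨n - k - 1, by omega⟩
  set n := k + (L + 1) with hndef
  have hn : (0 : ℝ) < n := by exact_mod_cast (by omega : 0 < n)
  have hL : (n : ℝ) - k = L + 1 := by rw [hndef]; push_cast; ring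
  have hwa : w a ≤ 1 := hs ▸ Finset.single_le_sum (fun b _ => hw b) (Finset.mem_univ a)
  refine (sum_prod_le_of_product_bound (k := k) (a := a) hw hs (u := 1 / 2) (v := 1)
    (K := 2 ^ L) (by norm_num) zero_le_one (by positivity) ?_).trans ?_
  · intro j hj hkj
    rw [one_pow, mul_one, one_div_pow, mul_one_div, one_le_div (by positivity)]
    exact pow_le_pow_right₀ (by norm_num) (by omega)
  · have h1 : w a * (1 / 2) + (1 - w a) * 1 ≤ Real.exp (-(5 * (L + 1) / n)) := by
      have := Real.add_one_le_exp (-(5 * ((L : ℝ) + 1) / n))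
      have h2 : 10 * ((L : ℝ) + 1) / n ≤ w a := by rw [← hL]; exact hp.trans hpa
      have h3 : 10 * ((L : ℝ) + 1) / n = 2 * (5 * (L + 1) / n) := by ring
      linarith
    have h3 : (w a * (1 / 2) + (1 - w a) * 1) ^ n ≤ (1 / 8) ^ (L + 1) := by
      calc _ ≤ Real.exp (-(5 * (L + 1) / n)) ^ n :=
            pow_le_pow_left₀ (by nlinarith [hw a]) h1 n
        _ = Real.exp (-5) ^ (L + 1) := by
            rw [← Real.exp_nat_mul, ← Real.exp_nat_mul]; congr 1; push_cast; field_simp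
        _ ≤ (1 / 8) ^ (L + 1) := by
            refine pow_le_pow_left₀ (Real.exp_pos _).le ?_ _
            have h5 : (8 : ℝ) ≤ Real.exp 5 := by
              have := Real.add_one_le_exp (1 : ℝ)
              calc (8 : ℝ) ≤ 2 ^ 5 := by norm_num
                _ ≤ Real.exp 1 ^ 5 := by gcongr; linarith
                _ = Real.exp 5 := by rw [← Real.exp_nat_mul]; norm_num
            rw [Real.exp_neg, ← one_div]
            exact one_div_le_one_div_of_le (by norm_num) h5
    calc _ ≤ (2 : ℝ) ^ L * (1 / 8) ^ (L + 1) := by gcongr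
      _ = 1 / 8 * (1 / 4) ^ L := by
          rw [pow_succ, ← mul_assoc, ← mul_pow]; norm_num; ring
      _ ≤ 1 / 8 := by
          have : (1 / 4 : ℝ) ^ L ≤ 1 := pow_le_one₀ (by norm_num) (by norm_num)
          linarith

/-! ### Moment matching and the chi-square divergence -/

/-- If the moments up to order `m` of two finitely supported laws on `[0, R]` agree and all but
`ε` of the mass of each sits at `0`, respectively at `Δ ≤ ε R`, then the quadratic form that
computes the chi-square divergence of the Gaussian mixtures is of order
`ε ^ 2 (e R ^ 2 / m) ^ m`. -/
lemma quadratic_form_le_of_moments_eq {ι : Type*} [Fintype ι] {w₀ w₁ x : ι → ℝ} {R Δ ε : ℝ}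
    {a₀ a₁ : ι} {m : ℕ} (hm : 1 ≤ m) (hR : 0 ≤ R) (hRm : R ^ 2 ≤ m) (hε : ε ≤ 1)
    (hw₀ : ∀ a, 0 ≤ w₀ a) (hw₁ : ∀ a, 0 ≤ w₁ a) (hs₀ : ∑ a, w₀ a = 1) (hs₁ : ∑ a, w₁ a = 1)
    (hx : ∀ a, 0 ≤ x a) (hxR : ∀ a, x a ≤ R) (hxa₀ : x a₀ = 0) (hxa₁ : x a₁ = Δ)
    (hΔR : Δ ≤ ε * R) (hp₀ : 1 - ε ≤ w₀ a₀) (hp₁ : 1 - ε ≤ w₁ a₁)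
    (hmom : ∀ j ≤ m, ∑ a, (w₁ a - w₀ a) * x a ^ j = 0) :
    ∑ a, ∑ b, (w₁ a - w₀ a) * (w₁ b - w₀ b) * Real.exp (x a * x b) ≤
      4 * ε ^ 2 * ((R ^ 2 / m) ^ m * Real.exp m) := by
  classical
  have hm0 : (0 : ℝ) < m := by exact_mod_cast hm
  have hexp : ∀ z : ℝ, HasSum (fun j : ℕ => z ^ j / (j.factorial : ℝ)) (Real.exp z) := fun z => by
    rw [Real.exp_eq_exp_ℝ]; exact NormedSpace.expSeries_div_hasSum_exp z
  have hsum : HasSum (fun j : ℕ => (∑ a, (w₁ a - w₀ a) * x a ^ j) ^ 2 / (j.factorial : ℝ))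
      (∑ a, ∑ b, (w₁ a - w₀ a) * (w₁ b - w₀ b) * Real.exp (x a * x b)) := by
    have h : HasSum (fun j : ℕ => ∑ a, ∑ b, (w₁ a - w₀ a) * (w₁ b - w₀ b) *
        ((x a * x b) ^ j / (j.factorial : ℝ)))
        (∑ a, ∑ b, (w₁ a - w₀ a) * (w₁ b - w₀ b) * Real.exp (x a * x b)) :=
      hasSum_sum fun a _ => hasSum_sum fun b _ => (hexp _).mul_left _
    convert h using 2 with j
    rw [sq, Finset.sum_mul_sum, Finset.sum_div]
    refine Finset.sum_congr rfl fun a _ => ?_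
    rw [Finset.sum_div]
    refine Finset.sum_congr rfl fun b _ => ?_
    rw [mul_pow]; ring
  have hmajor := ((hexp m).mul_left ((R ^ 2 / m) ^ m)).mul_left (4 * ε ^ 2)
  refine hasSum_le (fun j => ?_) hsum hmajor
  rcases le_or_gt j m with hj | hj
  · rw [hmom j hj]
    have : (0 : ℝ) ≤ R ^ 2 / m := by positivity
    simp only [ne_eq, OfNat.ofNat_ne_zero, not_false_eq_true, zero_pow, zero_div]
    positivity
  have hj0 : j ≠ 0 := by omega
  have hε0 : 0 ≤ ε := by
    have := Finset.single_le_sum (fun b _ => hw₀ b) (Finset.mem_univ a₀)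
    linarith
  have hΔ0 : 0 ≤ Δ := hxa₁ ▸ hx a₁
  -- All but the heaviest atom of a law together contribute at most `ε R ^ j`.
  have hrest : ∀ (w : ι → ℝ) (a : ι), (∀ b, 0 ≤ w b) → ∑ b, w b = 1 → 1 - ε ≤ w a →
      ∑ b, w b * x b ^ j ≤ x a ^ j + ε * R ^ j := fun w a hw hs hp => by
    rw [← Finset.add_sum_erase _ _ (Finset.mem_univ a)] at hs ⊢
    have h0 : 0 ≤ ∑ b ∈ Finset.univ.erase a, w b := Finset.sum_nonneg fun b _ => hw b
    have h1 : w a * x a ^ j ≤ x a ^ j :=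
      mul_le_of_le_one_left (pow_nonneg (hx a) j) (by linarith)
    have h2 : ∑ b ∈ Finset.univ.erase a, w b * x b ^ j ≤
        ∑ b ∈ Finset.univ.erase a, w b * R ^ j :=
      Finset.sum_le_sum fun b _ =>
        mul_le_mul_of_nonneg_left (pow_le_pow_left₀ (hx b) (hxR b) j) (hw b)
    rw [← Finset.sum_mul] at h2
    have h3 : (∑ b ∈ Finset.univ.erase a, w b) * R ^ j ≤ ε * R ^ j :=
      mul_le_mul_of_nonneg_right (by linarith) (pow_nonneg hR j)
    linarith
  have hΔj : Δ ^ j ≤ ε * R ^ j := by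
    calc Δ ^ j ≤ (ε * R) ^ j := pow_le_pow_left₀ hΔ0 hΔR j
      _ = ε ^ j * R ^ j := mul_pow _ _ _
      _ ≤ ε * R ^ j := mul_le_mul_of_nonneg_right (pow_le_of_le_one hε0 hε hj0) (pow_nonneg hR j)
  have h0 := hrest w₀ a₀ hw₀ hs₀ hp₀
  have h1 := hrest w₁ a₁ hw₁ hs₁ hp₁
  rw [hxa₀, zero_pow hj0] at h0
  rw [hxa₁] at h1
  have h0' : 0 ≤ ∑ b, w₀ b * x b ^ j :=
    Finset.sum_nonneg fun b _ => mul_nonneg (hw₀ b) (pow_nonneg (hx b) j)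
  have h1' : 0 ≤ ∑ b, w₁ b * x b ^ j :=
    Finset.sum_nonneg fun b _ => mul_nonneg (hw₁ b) (pow_nonneg (hx b) j)
  have hRj : 0 ≤ ε * R ^ j := mul_nonneg hε0 (pow_nonneg hR j)
  have habs : (∑ a, (w₁ a - w₀ a) * x a ^ j) ^ 2 ≤ (2 * (ε * R ^ j)) ^ 2 := by
    refine sq_le_sq' ?_ ?_ <;> simp only [sub_mul, Finset.sum_sub_distrib] <;> linarith
  have hpow : R ^ (2 * j) ≤ (R ^ 2 / m) ^ m * (m : ℝ) ^ j := by
    have h2 : R ^ 2 / m ≤ 1 := (div_le_one hm0).2 hRm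
    calc R ^ (2 * j) = (R ^ 2 / m) ^ j * (m : ℝ) ^ j := by
          rw [div_pow, div_mul_cancel₀ _ (by positivity), pow_mul]
      _ ≤ _ := mul_le_mul_of_nonneg_right
          (pow_le_pow_of_le_one (by positivity) h2 hj.le) (by positivity)
  calc (∑ a, (w₁ a - w₀ a) * x a ^ j) ^ 2 / (j.factorial : ℝ)
      ≤ (2 * (ε * R ^ j)) ^ 2 / (j.factorial : ℝ) := by gcongr
    _ = 4 * ε ^ 2 * R ^ (2 * j) / (j.factorial : ℝ) := by rw [pow_mul']; ring
    _ ≤ 4 * ε ^ 2 * ((R ^ 2 / m) ^ m * (m : ℝ) ^ j) / (j.factorial : ℝ) := by gcongr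
    _ = _ := by ring

/-! ### Extrapolation from Chebyshev nodes -/

open Polynomial Polynomial.Chebyshev in
/-- Lagrange interpolation at the extremal points of the Chebyshev polynomial `T_m`, evaluated at
`cosh t > 1`. The weights alternate in sign, so that the sum of their absolute values is the value
`T_m (cosh t) = cosh (m t)`. -/
theorem exists_chebyshev_extrapolation (m : ℕ) {t : ℝ} (ht : 0 < t) :
    ∃ l : ℕ → ℝ,
      (∀ P : ℝ[X], P.natDegree ≤ m →
        ∑ i ∈ Finset.range (m + 1), l i * P.eval (node m i) = P.eval (Real.cosh t)) ∧
      1 ≤ l 0 ∧ ∑ i ∈ Finset.range (m + 1), |l i| = Real.cosh (m * t) := by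
  have hc : 1 < Real.cosh t := Real.one_lt_cosh.2 ht.ne'
  set s := Finset.range (m + 1) with hs
  have hinj : Set.InjOn (node m ·) s := (strictAntiOn_node m).injOn
  set l : ℕ → ℝ := fun i => (Lagrange.basis s (node m ·) i).eval (Real.cosh t) with hl
  have hrep : ∀ P : ℝ[X], P.natDegree ≤ m →
      ∑ i ∈ s, l i * P.eval (node m i) = P.eval (Real.cosh t) := fun P hP => by
    have hdeg : P.degree < s.card := by
      rw [hs, Finset.card_range]
      exact (degree_le_of_natDegree_le hP).trans_lt (by exact_mod_cast Nat.lt_succ_self m)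
    conv_rhs => rw [Lagrange.eq_interpolate hinj hdeg, Lagrange.interpolate_apply]
    rw [eval_finsetSum]
    exact Finset.sum_congr rfl fun i _ => by rw [eval_mul, eval_C, mul_comm]
  have hle : ∀ j, node m j ≤ 1 := fun j => node_mem_Icc.2
  have heval : ∀ i, l i = (∏ j ∈ s.erase i, (node m i - node m j))⁻¹ *
      ∏ j ∈ s.erase i, (Real.cosh t - node m j) := fun i => by
    simp only [hl, Lagrange.basis, eval_prod, Lagrange.basisDivisor, eval_mul, eval_C, eval_sub,
      eval_X, Finset.prod_mul_distrib, Finset.prod_inv_distrib]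
  have hsign : ∀ i ∈ s, |l i| = l i * (-1) ^ i := fun i hi => by
    have him : i ≤ m := Nat.lt_succ_iff.1 (Finset.mem_range.1 hi)
    have h1 : 0 < ∏ j ∈ s.erase i, (Real.cosh t - node m j) :=
      Finset.prod_pos fun j _ => by linarith [hle j]
    have h2 := zero_lt_prod_node_sub_node him
    have h3 : 0 < l i * (-1) ^ i := by
      rw [heval]
      have h4 : (∏ j ∈ s.erase i, (node m i - node m j))⁻¹ =
          (-1) ^ i * ((-1) ^ i * ∏ j ∈ s.erase i, (node m i - node m j))⁻¹ := by
        rw [mul_inv, ← mul_assoc]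
        rcases neg_one_pow_eq_or ℝ i with h | h <;> rw [h] <;> norm_num
      have h5 : ((-1 : ℝ) ^ i) * (-1) ^ i = 1 := by rw [← mul_pow]; norm_num
      rw [h4]
      calc 0 < ((-1) ^ i * ∏ j ∈ s.erase i, (node m i - node m j))⁻¹ *
            ∏ j ∈ s.erase i, (Real.cosh t - node m j) := mul_pos (inv_pos.2 h2) h1
        _ = ((-1 : ℝ) ^ i * (-1) ^ i) * (((-1) ^ i * ∏ j ∈ s.erase i, (node m i - node m j))⁻¹ *
            ∏ j ∈ s.erase i, (Real.cosh t - node m j)) := by rw [h5, one_mul]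
        _ = _ := by ring
    rw [← abs_of_pos h3, abs_mul, abs_neg_one_pow, mul_one]
  refine ⟨l, hrep, ?_, ?_⟩
  · rw [heval, ← Finset.prod_inv_distrib, ← Finset.prod_mul_distrib]
    refine Finset.prod_induction _ (fun r : ℝ => 1 ≤ r)
      (fun _ _ => one_le_mul_of_one_le_of_one_le) le_rfl fun j hj => ?_
    have hj0 : 0 < j := Nat.pos_of_ne_zero (Finset.ne_of_mem_erase hj)
    have hjm : j ≤ m := Nat.lt_succ_iff.1 (Finset.mem_range.1 (Finset.mem_of_mem_erase hj))
    have h1 : 0 < node m 0 - node m j := sub_pos.2 (node_lt hjm hj0)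
    rw [← div_eq_inv_mul, one_le_div h1, node_eq_one]
    linarith
  · rw [Finset.sum_congr rfl hsign, ← Int.cast_natCast m, ← T_real_cosh, ← hrep _ (by simp)]
    refine Finset.sum_congr rfl fun i hi => ?_
    rw [eval_T_real_node (Finset.mem_Iic.2 (Nat.lt_succ_iff.1 (Finset.mem_range.1 hi)))]

/-! ### The moment-matching priors -/

/-- The extrapolation formula after the affine change of variables that sends `cosh t` to `0` and
the Chebyshev nodes to `M / 2 * (cosh t - node m i)`, stated for monomials. -/
lemma exists_weights_at_zero (m : ℕ) {t : ℝ} (ht : 0 < t) (M : ℝ) :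
    ∃ l : Fin (m + 1) → ℝ,
      (∀ j ≤ m, ∑ i, l i * (M / 2 * (Real.cosh t - Polynomial.Chebyshev.node m i)) ^ j =
        (0 : ℝ) ^ j) ∧
      1 ≤ l 0 ∧ ∑ i, |l i| = Real.cosh (m * t) := by
  obtain ⟨l, h1, h2, h3⟩ := exists_chebyshev_extrapolation m ht
  refine ⟨fun i => l i, fun j hj => ?_, h2, ?_⟩
  · have hdeg : ((Polynomial.C (M / 2) *
        (Polynomial.C (Real.cosh t) - Polynomial.X)) ^ j).natDegree ≤ m := by
      have hlin : (Polynomial.C (M / 2) *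
          (Polynomial.C (Real.cosh t) - Polynomial.X)).natDegree ≤ 1 := by
        refine (Polynomial.natDegree_C_mul_le _ _).trans ?_
        exact (Polynomial.natDegree_sub_le _ _).trans (by simp)
      exact (Polynomial.natDegree_pow_le_of_le j hlin).trans (by omega)
    have := h1 _ hdeg
    simp only [Polynomial.eval_pow, Polynomial.eval_mul, Polynomial.eval_C, Polynomial.eval_sub,
      Polynomial.eval_X, sub_self, mul_zero] at this
    rw [← this, Finset.sum_range]
  · rw [← h3, Finset.sum_range]

lemma sinh_one_sq_le : Real.sinh 1 ^ 2 ≤ 2 := by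
  have h1 : Real.sinh 1 ≤ 1.36 := by
    rw [Real.sinh_eq]
    have := Real.exp_one_lt_d9
    have := Real.exp_pos (-1)
    linarith
  have h2 : 0 ≤ Real.sinh 1 := Real.sinh_nonneg_iff.2 zero_le_one
  nlinarith

lemma sinh_log_one_add_le {s : ℝ} (hs : 0 ≤ s) : Real.sinh (Real.log (1 + s)) ≤ s := by
  have h : 0 < 1 + s := by linarith
  rw [Real.sinh_eq, Real.exp_neg, Real.exp_log h]
  have : 1 - s ≤ (1 + s)⁻¹ := by
    rw [← one_div, le_div_iff₀ h]
    nlinarith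
  linarith

lemma sinh_log_sq_le {ε : ℝ} (hε0 : 0 < ε) (hε1 : ε < 1) :
    Real.sinh (Real.log (1 + √(ε / (1 - ε)))) ^ 2 ≤ ε / (1 - ε) := by
  have hε' : 0 < 1 - ε := by linarith
  have hs : 0 ≤ √(ε / (1 - ε)) := Real.sqrt_nonneg _
  refine (pow_le_pow_left₀ ?_ (sinh_log_one_add_le hs) 2).trans
    (Real.sq_sqrt (by positivity)).le
  exact Real.sinh_nonneg_iff.2 (Real.log_nonneg (by linarith))

lemma sinh_sq_le_four_mul {ε r : ℝ} (hε0 : 0 < ε) (hε1 : ε < 1) (hr0 : 0 < r) (hr1 : r ≤ 1)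
    (hr : r ≤ Real.log (1 + √(ε / (1 - ε)))) :
    Real.sinh r ^ 2 ≤ 2 ∧ Real.sinh r ^ 2 ≤ 4 * ε := by
  have h0 : 0 ≤ Real.sinh r := Real.sinh_nonneg_iff.2 hr0.le
  have h2 : Real.sinh r ^ 2 ≤ 2 :=
    (pow_le_pow_left₀ h0 (Real.sinh_le_sinh.2 hr1) 2).trans sinh_one_sq_le
  refine ⟨h2, ?_⟩
  rcases le_or_gt (1 / 2) ε with h | h
  · linarith
  · have h1 : Real.sinh r ^ 2 ≤ ε / (1 - ε) :=
      (pow_le_pow_left₀ h0 (Real.sinh_le_sinh.2 hr) 2).trans (sinh_log_sq_le hε0 hε1)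
    refine h1.trans ?_
    rw [div_le_iff₀ (by linarith)]
    nlinarith

/-- The numerical reason for taking the nodes in an interval of length `√m / 250`. -/
lemma pow_mul_exp_le {m : ℕ} (hm : 1 ≤ m) :
    (16 / 62500 : ℝ) ^ m * Real.exp m * Real.exp (2 * m) ≤ 1 / 128 := by
  have hq : (16 / 62500 : ℝ) * Real.exp 3 ≤ 1 / 128 := by
    have h2 : Real.exp 3 = Real.exp 1 ^ 3 := by rw [← Real.exp_nat_mul]; norm_num
    have h3 : Real.exp 1 ^ 3 ≤ 2.72 ^ 3 :=
      pow_le_pow_left₀ (Real.exp_pos _).le (by linarith [Real.exp_one_lt_d9]) 3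
    rw [h2]
    norm_num at h3 ⊢
    linarith
  have h2 : (16 / 62500 : ℝ) ^ m * Real.exp m * Real.exp (2 * m) =
      (16 / 62500 * Real.exp 3) ^ m := by
    rw [mul_pow, ← Real.exp_nat_mul, mul_assoc, ← Real.exp_add]
    congr 2; ring
  rw [h2]
  exact (pow_le_of_le_one (by positivity) (hq.trans (by norm_num)) (by omega)).trans hq

/-- The lower bound for a given contamination probability `ε` and a given number `m` of matched
moments. The first prior charges `0` and the odd Chebyshev nodes, the second one the even nodes,
the smallest of which is the separation `Δ`. -/
theorem ofReal_le_minimaxRisk_of_moments {n k m : ℕ} {ε : ℝ} (hε0 : 0 < ε) (hε1 : ε < 1)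
    (hm : 1 ≤ m) (hlog : Real.log (1 + √(ε / (1 - ε))) ≤ m)
    (hn : n * ε ^ 2 ≤ (1 - ε) * Real.exp (2 * m)) (htail : FewOutliers n k (1 - ε)) :
    ENNReal.ofReal (Real.log (1 + √(ε / (1 - ε))) ^ 2 / (2000 * (m * √m))) ≤
      minimaxRisk k n := by
  have hm0 : (0 : ℝ) < m := by exact_mod_cast hm
  have hε' : 0 < 1 - ε := by linarith
  set s := √(ε / (1 - ε)) with hs
  have hs0 : 0 < s := Real.sqrt_pos.2 (by positivity)
  set ℓ := Real.log (1 + s) with hℓ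
  have hℓ0 : 0 < ℓ := Real.log_pos (by linarith)
  set r := ℓ / m with hr
  have hr0 : 0 < r := by positivity
  have hr1 : r ≤ 1 := (div_le_one hm0).2 hlog
  have hrℓ : r ≤ ℓ := div_le_self hℓ0.le (by exact_mod_cast hm)
  set M := √m / 250 with hM
  have hsm : 0 < √(m : ℝ) := Real.sqrt_pos.2 hm0
  have hM0 : 0 < M := by positivity
  have hcosh : Real.cosh (2 * r) = 1 + 2 * Real.sinh r ^ 2 := by
    rw [Real.cosh_two_mul, Real.cosh_sq]; ring
  have hsinhr : 0 < Real.sinh r := Real.sinh_pos_iff.2 hr0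
  obtain ⟨hsinhr2, hsinhε⟩ := sinh_sq_le_four_mul hε0 hε1 hr0 hr1 hrℓ
  obtain ⟨l, hl1, hl2, hl3⟩ := exists_weights_at_zero m (t := 2 * r) (by positivity) M
  set τ := Real.cosh (m * (2 * r)) with hτ
  have hτ1 : 1 ≤ τ := Real.one_le_cosh _
  have hτle : τ ≤ 1 + 2 * (ε / (1 - ε)) := by
    have h1 : (m : ℝ) * (2 * r) = 2 * ℓ := by rw [hr]; field_simp
    have h2 : Real.sinh ℓ ^ 2 ≤ ε / (1 - ε) := sinh_log_sq_le hε0 hε1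
    rw [hτ, h1, Real.cosh_two_mul, Real.cosh_sq]
    linarith only [h2]
  set p := 2 / (1 + τ) with hp
  have hp0 : 0 < p := by positivity
  have hpε : 1 - ε ≤ p := by
    rw [hp, le_div_iff₀ (by linarith)]
    have h1 : (1 - ε) * (ε / (1 - ε)) = ε := mul_div_cancel₀ _ hε'.ne'
    have h2 := mul_le_mul_of_nonneg_left hτle hε'.le
    linarith only [h1, h2, hM0]
  have hsum1 : ∑ i, l i = 1 := by simpa using hl1 0 (Nat.zero_le _)
  set y : Fin (m + 1) → ℝ := fun i =>
    M / 2 * (Real.cosh (2 * r) - Polynomial.Chebyshev.node m i) with hy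
  set Δ := M * Real.sinh r ^ 2 with hΔ
  have hΔ0 : 0 < Δ := by positivity
  have hyΔ : ∀ i, Δ ≤ y i := fun i => by
    have := (Polynomial.Chebyshev.node_mem_Icc (n := m) (i := i)).2
    simp only [hy, hΔ, hcosh]
    have := mul_le_mul_of_nonneg_left this hM0.le
    linarith only [this]
  have hyR : ∀ i, y i ≤ 4 * M := fun i => by
    have := (Polynomial.Chebyshev.node_mem_Icc (n := m) (i := i)).1
    simp only [hy, hcosh]
    have h1 := mul_le_mul_of_nonneg_left this hM0.le
    have h2 := mul_le_mul_of_nonneg_left hsinhr2 hM0.le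
    linarith only [h1, h2, hM0]
  have hy0 : y 0 = Δ := by
    simp only [hy, hΔ, hcosh, Fin.val_zero, Polynomial.Chebyshev.node_eq_one]; ring
  set w₀ : Option (Fin (m + 1)) → ℝ := fun a => a.elim p fun i => p * ((|l i| - l i) / 2) with hw₀
  set w₁ : Option (Fin (m + 1)) → ℝ := fun a => a.elim 0 fun i => p * ((|l i| + l i) / 2) with hw₁
  set x : Option (Fin (m + 1)) → ℝ := fun a => a.elim 0 y with hx
  have hw₀nn : ∀ a, 0 ≤ w₀ a := by
    rintro (_ | i)
    · exact hp0.le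
    · exact mul_nonneg hp0.le (by linarith [le_abs_self (l i)])
  have hw₁nn : ∀ a, 0 ≤ w₁ a := by
    rintro (_ | i)
    · exact le_rfl
    · exact mul_nonneg hp0.le (by linarith [neg_abs_le (l i)])
  have hpτ : p * (1 + τ) = 2 := div_mul_cancel₀ _ (by linarith)
  have hs₀ : ∑ a, w₀ a = 1 := by
    rw [Fintype.sum_option]
    simp only [hw₀, Option.elim]
    rw [← Finset.mul_sum, ← Finset.sum_div, Finset.sum_sub_distrib, hl3, hsum1]
    linarith
  have hs₁ : ∑ a, w₁ a = 1 := by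
    rw [Fintype.sum_option]
    simp only [hw₁, Option.elim]
    rw [← Finset.mul_sum, ← Finset.sum_div, Finset.sum_add_distrib, hl3, hsum1]
    linarith
  have hxnn : ∀ a, 0 ≤ x a := by
    rintro (_ | i)
    · exact le_rfl
    · exact hΔ0.le.trans (hyΔ i)
  have hxR : ∀ a, x a ≤ 4 * M := by
    rintro (_ | i)
    · exact (by positivity : (0 : ℝ) ≤ 4 * M)
    · exact hyR i
  have hp₁ : 1 - ε ≤ w₁ (some 0) := by
    have h0 : (1 : ℝ) ≤ (|l 0| + l 0) / 2 := by
      have := le_abs_self (l 0)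
      linarith only [this, hl2]
    exact hpε.trans (le_mul_of_one_le_right hp0.le h0)
  have hmom : ∀ j ≤ m, ∑ a, (w₁ a - w₀ a) * x a ^ j = 0 := fun j hj => by
    rw [Fintype.sum_option]
    simp only [hw₁, hw₀, hx, Option.elim]
    have h1 : ∀ i, (p * ((|l i| + l i) / 2) - p * ((|l i| - l i) / 2)) * y i ^ j =
        p * (l i * y i ^ j) := fun i => by ring
    simp_rw [h1]
    rw [← Finset.mul_sum, hl1 j hj]
    ring
  have hM2 : (4 * M) ^ 2 = 16 / 62500 * m := by
    rw [hM, mul_pow, div_pow, Real.sq_sqrt hm0.le]; ring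
  have hΔR : Δ ≤ ε * (4 * M) := by
    have := mul_le_mul_of_nonneg_left hsinhε hM0.le
    rw [hΔ]
    linarith only [this]
  have hquad := quadratic_form_le_of_moments_eq (R := 4 * M) (Δ := Δ) (ε := ε) (a₀ := none)
    (a₁ := some 0) hm (by positivity) (by rw [hM2]; linarith) hε1.le hw₀nn hw₁nn hs₀ hs₁ hxnn hxR
    rfl hy0 hΔR hpε hp₁ hmom
  have hχ : n * (∑ a, ∑ b, (w₁ a - w₀ a) * (w₁ b - w₀ b) * Real.exp (x a * x b)) ≤
      (1 - ε) / 32 := by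
    have h1 : (4 * M) ^ 2 / m = 16 / 62500 := by rw [hM2]; field_simp
    rw [h1] at hquad
    have hqm := pow_mul_exp_le hm
    calc _ ≤ n * (4 * ε ^ 2 * ((16 / 62500) ^ m * Real.exp m)) := by gcongr
      _ = 4 * (n * ε ^ 2) * ((16 / 62500) ^ m * Real.exp m) := by ring
      _ ≤ 4 * ((1 - ε) * Real.exp (2 * m)) * ((16 / 62500) ^ m * Real.exp m) := by gcongr
      _ = 4 * (1 - ε) * ((16 / 62500) ^ m * Real.exp m * Real.exp (2 * m)) := by ring
      _ ≤ 4 * (1 - ε) * (1 / 128) := by gcongr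
      _ = (1 - ε) / 32 := by ring
  refine le_trans (ENNReal.ofReal_le_ofReal ?_) (ofReal_le_minimaxRisk_of_priors (a₀ := none)
    (a₁ := some 0) hΔ0 hε' hw₀nn hw₁nn hs₀ hs₁ hxnn rfl hy0 ?_ hpε hp₁ htail hχ)
  · have h1 : r ^ 2 ≤ Real.sinh r ^ 2 :=
      pow_le_pow_left₀ hr0.le (Real.self_le_sinh_iff.2 hr0.le) 2
    have h2 : ℓ ^ 2 / (2000 * (m * √m)) = M * r ^ 2 / 8 := by
      rw [hM, hr]
      have h3 : √(m : ℝ) * √m = m := Real.mul_self_sqrt hm0.le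
      field_simp
      rw [sq, h3]; ring
    rw [h2, hΔ]
    gcongr
  · rintro (_ | i) h
    · exact absurd rfl h
    · exact hyΔ i

/-- The parametric lower bound: a shift of all observations by
`1 / (8 √n)` cannot be detected reliably. -/
theorem ofReal_parametric_le_minimaxRisk {n k : ℕ} (hk : 1 ≤ k) (hkn : k ≤ n) :
    ENNReal.ofReal (1 / (64 * √n)) ≤ minimaxRisk k n := by
  have hn : (1 : ℝ) ≤ n := by exact_mod_cast hk.trans hkn
  have hsn : 1 ≤ √(n : ℝ) := Real.one_le_sqrt.2 hn
  have hsn2 : √(n : ℝ) ^ 2 = n := Real.sq_sqrt (by linarith)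
  set Δ := 1 / (8 * √(n : ℝ)) with hΔ
  have hΔ0 : 0 < Δ := by positivity
  have hΔ2 : Δ ^ 2 = 1 / (64 * n) := by rw [hΔ, div_pow, mul_pow, hsn2]; norm_num
  have htail : FewOutliers n k 1 :=
    fewOutliers_of_sparse hk hkn (by linarith [show (0 : ℝ) ≤ k / (10 * n) by positivity])
  have h := ofReal_le_minimaxRisk_of_priors (n := n) (k := k) (ι := Bool)
    (w₀ := fun a => if a then 0 else 1) (w₁ := fun a => if a then 1 else 0)
    (x := fun a => if a then Δ else 0) (p := 1) (Δ := Δ) (a₀ := false) (a₁ := true) hΔ0 one_pos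
    (by intro a; split_ifs <;> norm_num)
    (by intro a; split_ifs <;> norm_num) (by simp) (by simp)
    (by intro a; split_ifs <;> positivity) (by simp) (by simp)
    (by intro a ha; cases a <;> simp_all) (by simp) (by simp) htail ?_
  · convert h using 2
    rw [hΔ]; field_simp; norm_num
  · have he : Real.exp (Δ * Δ) ≤ 1 + 2 * Δ ^ 2 := by
      have h1 : Δ ^ 2 ≤ 1 / 2 := by
        rw [hΔ2]
        exact one_div_le_one_div_of_le (by norm_num) (by linarith)
      have h2 := Real.exp_bound_div_one_sub_of_interval (x := Δ * Δ) (by positivity)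
        (by nlinarith)
      refine h2.trans ?_
      rw [div_le_iff₀ (by nlinarith)]
      nlinarith [mul_nonneg (sq_nonneg Δ) (by linarith : 0 ≤ 1 / 2 - Δ ^ 2)]
    have h3 : (n : ℝ) * (2 * Δ ^ 2) = 1 / 32 := by rw [hΔ2]; field_simp; norm_num
    simp only [Fintype.sum_bool, if_true, Bool.false_eq_true, if_false]
    norm_num
    nlinarith

/-! ### Comparison with the stated rate -/

lemma log_one_add_sqrt_le {q q' : ℝ} (h : q ≤ 225 * q') :
    Real.log (1 + √q) ≤ 15 * Real.log (1 + √q') := by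
  have h0 : 0 ≤ √q := Real.sqrt_nonneg _
  have h1 : 0 ≤ √q' := Real.sqrt_nonneg _
  have h2 : √q ≤ 15 * √q' := by
    calc √q ≤ √(15 ^ 2 * q') := Real.sqrt_le_sqrt (by linarith)
      _ = 15 * √q' := by rw [Real.sqrt_mul (by norm_num), Real.sqrt_sq (by norm_num)]
  have h3 : 1 + ((15 : ℕ) : ℝ) * √q' ≤ (1 + √q') ^ 15 :=
    one_add_mul_le_pow (by linarith) 15
  calc Real.log (1 + √q) ≤ Real.log ((1 + √q') ^ 15) :=
        Real.log_le_log (by linarith) (by push_cast at h3; linarith)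
    _ = 15 * Real.log (1 + √q') := by rw [Real.log_pow]; norm_num

lemma rpow_three_halves {D : ℝ} (hD : 0 < D) : D ^ (3 / 2 : ℝ) = D * √D := by
  rw [show (3 / 2 : ℝ) = 1 + 1 / 2 by norm_num, Real.rpow_add hD, Real.rpow_one,
    Real.sqrt_eq_rpow]

/-- The stated rate is at most a constant times the bound obtained from `m` matched moments, as
soon as `m` is at most a constant times `D`. -/
lemma rate_le_of_le {S ℓ D : ℝ} {m : ℕ} (hm : 1 ≤ m) (hS0 : 0 ≤ S) (hS : S ≤ 15 * ℓ)
    (hmD : (m : ℝ) ≤ 16 * D) :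
    1 / 28800000 * (S ^ 2 / D ^ (3 / 2 : ℝ)) ≤ ℓ ^ 2 / (2000 * (m * √m)) := by
  have hm0 : (0 : ℝ) < m := by exact_mod_cast hm
  have hD : 0 < D := by linarith
  have hsq : √(m : ℝ) ≤ 4 * √D := by
    calc √(m : ℝ) ≤ √(4 ^ 2 * D) := Real.sqrt_le_sqrt (by linarith)
      _ = 4 * √D := by rw [Real.sqrt_mul (by norm_num), Real.sqrt_sq (by norm_num)]
  have hsm : 0 < √(m : ℝ) := Real.sqrt_pos.2 hm0
  have hsD : 0 < √D := Real.sqrt_pos.2 hD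
  rw [rpow_three_halves hD]
  calc 1 / 28800000 * (S ^ 2 / (D * √D)) ≤ 1 / 28800000 * ((15 * ℓ) ^ 2 / (D * √D)) := by gcongr
    _ = ℓ ^ 2 / (2000 * (16 * D * (4 * √D))) := by field_simp; ring
    _ ≤ _ := by gcongr

lemma log_two_ge : (2 / 3 : ℝ) ≤ Real.log 2 := by linarith [Real.log_two_gt_d9]

/-- The logarithm of `k ^ 2 / n` in terms of the denominator of the rate. -/
lemma log_sq_div_le {n k : ℕ} (hn : 0 < n) (hkn : n ≤ k ^ 2) :
    2 / 3 ≤ Real.log (1 + ((k : ℝ) / √n) ^ (2 / 3 : ℝ)) ∧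
      Real.log ((k : ℝ) ^ 2 / n) ≤ 3 * Real.log (1 + ((k : ℝ) / √n) ^ (2 / 3 : ℝ)) := by
  have hn0 : (0 : ℝ) < n := by exact_mod_cast hn
  have hsn : 0 < √(n : ℝ) := Real.sqrt_pos.2 hn0
  have hz : 1 ≤ (k : ℝ) / √n := by
    rw [one_le_div hsn]
    exact Real.sqrt_le_iff.2 ⟨by positivity, by exact_mod_cast hkn⟩
  have hz0 : 0 < (k : ℝ) / √n := by linarith
  have hv : 1 ≤ ((k : ℝ) / √n) ^ (2 / 3 : ℝ) := Real.one_le_rpow hz (by norm_num)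
  refine ⟨log_two_ge.trans (Real.log_le_log (by norm_num) (by linarith)), ?_⟩
  have h1 : (k : ℝ) ^ 2 / n = ((k : ℝ) / √n) ^ 2 := by rw [div_pow, Real.sq_sqrt hn0.le]
  have h2 : Real.log (((k : ℝ) / √n) ^ (2 / 3 : ℝ)) ≤
      Real.log (1 + ((k : ℝ) / √n) ^ (2 / 3 : ℝ)) :=
    Real.log_le_log (by linarith) (by linarith)
  rw [Real.log_rpow hz0] at h2
  rw [h1, Real.log_pow]
  push_cast
  linarith

/-- Below the threshold `k = √n` the stated rate is parametric. -/
lemma rate_le_parametric {n k : ℕ} (hk : 1 ≤ k) (hkn : k < n) (h : k ^ 2 ≤ n) :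
    1 / 28800000 * (Real.log (1 + √((k : ℝ) / (n - k))) ^ 2 /
      Real.log (1 + ((k : ℝ) / √n) ^ (2 / 3 : ℝ)) ^ (3 / 2 : ℝ)) ≤ 1 / (64 * √n) := by
  have hk0 : (1 : ℝ) ≤ k := by exact_mod_cast hk
  have hn2 : (2 : ℝ) ≤ n := by exact_mod_cast (by omega : 2 ≤ n)
  have h' : (k : ℝ) ^ 2 ≤ n := by exact_mod_cast h
  have hsn : 0 < √(n : ℝ) := Real.sqrt_pos.2 (by linarith)
  have hsn2 : √(n : ℝ) * √n = n := Real.mul_self_sqrt (by linarith)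
  have hgap : (n : ℝ) / 4 ≤ n - k := by nlinarith
  have hgap0 : (0 : ℝ) < n - k := by linarith
  have hS : Real.log (1 + √((k : ℝ) / (n - k))) ^ 2 ≤ 4 * k / n := by
    have h0 : 0 ≤ √((k : ℝ) / (n - k)) := Real.sqrt_nonneg _
    have h1 : Real.log (1 + √((k : ℝ) / (n - k))) ≤ √((k : ℝ) / (n - k)) := by
      have := Real.log_le_sub_one_of_pos (by linarith : 0 < 1 + √((k : ℝ) / (n - k)))
      linarith
    calc _ ≤ √((k : ℝ) / (n - k)) ^ 2 :=
          pow_le_pow_left₀ (Real.log_nonneg (by linarith)) h1 2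
      _ = k / (n - k) := Real.sq_sqrt (by positivity)
      _ ≤ k / (n / 4) := by gcongr
      _ = 4 * k / n := by field_simp
  set z := (k : ℝ) / √n with hz
  have hz0 : 0 < z := by positivity
  have hz1 : z ≤ 1 := by
    rw [hz, div_le_one hsn]
    exact Real.le_sqrt_of_sq_le h'
  have hv0 : 0 < z ^ (2 / 3 : ℝ) := Real.rpow_pos_of_pos hz0 _
  have hv1 : z ^ (2 / 3 : ℝ) ≤ 1 := Real.rpow_le_one hz0.le hz1 (by norm_num)
  have hD : z ^ (2 / 3 : ℝ) / 4 ≤ Real.log (1 + z ^ (2 / 3 : ℝ)) := by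
    have h1 := Real.one_sub_inv_le_log_of_pos (by linarith : 0 < 1 + z ^ (2 / 3 : ℝ))
    refine le_trans ?_ h1
    rw [le_sub_iff_add_le, ← le_sub_iff_add_le', ← one_div, div_le_iff₀ (by linarith)]
    nlinarith
  have hD' : z / 8 ≤ Real.log (1 + z ^ (2 / 3 : ℝ)) ^ (3 / 2 : ℝ) := by
    have h4 : (4 : ℝ) ^ (3 / 2 : ℝ) = 8 := by
      rw [rpow_three_halves (by norm_num), show (4 : ℝ) = 2 ^ 2 by norm_num,
        Real.sqrt_sq (by norm_num)]
      norm_num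
    calc z / 8 = (z ^ (2 / 3 : ℝ) / 4) ^ (3 / 2 : ℝ) := by
          rw [Real.div_rpow hv0.le (by norm_num), ← Real.rpow_mul hz0.le, h4]
          norm_num
      _ ≤ _ := Real.rpow_le_rpow (by positivity) hD (by norm_num)
  calc _ ≤ 1 / 28800000 * (4 * k / n / (z / 8)) := by gcongr
    _ = 1 / 28800000 * (32 / √n) := by
        rw [hz]
        nth_rewrite 1 [← hsn2]
        field_simp
        norm_num
    _ ≤ 1 / (64 * √n) := by
        rw [mul_div_assoc', div_le_div_iff₀ hsn (by positivity)]
        nlinarith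

/-- The lower bound when `k` exceeds `√n` but a fixed proportion of the coordinates is
uncontaminated: the contamination probability is `k / (10 n)`, and about `log (k ^ 2 / n)` moments
are matched. -/
lemma rate_le_minimaxRisk_sparse {n k : ℕ} (hkn : k < n) (h : n < k ^ 2)
    (hgap : n < 20 * (n - k)) :
    ENNReal.ofReal (1 / 28800000 * (Real.log (1 + √((k : ℝ) / (n - k))) ^ 2 /
      Real.log (1 + ((k : ℝ) / √n) ^ (2 / 3 : ℝ)) ^ (3 / 2 : ℝ))) ≤ minimaxRisk k n := by
  have hk : 1 ≤ k := by
    rcases Nat.eq_zero_or_pos k with rfl | hk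
    · simp at h
    · exact hk
  have hn0 : (0 : ℝ) < n := by exact_mod_cast (by omega : 0 < n)
  have hk0 : (1 : ℝ) ≤ k := by exact_mod_cast hk
  have hkn' : (k : ℝ) < n := by exact_mod_cast hkn
  have h' : (n : ℝ) < k ^ 2 := by exact_mod_cast h
  have hgap' : (n : ℝ) < 20 * (n - k) := by
    have : ((n : ℕ) : ℝ) < ((20 * (n - k) : ℕ) : ℝ) := by exact_mod_cast hgap
    push_cast [Nat.cast_sub hkn.le] at this
    exact this
  obtain ⟨hD, hlogκ⟩ := log_sq_div_le (by omega) h.le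
  set κ := (k : ℝ) ^ 2 / n with hκ
  have hκ1 : 1 < κ := (one_lt_div hn0).2 h'
  set ε := (k : ℝ) / (10 * n) with hε
  have hε0 : 0 < ε := by positivity
  have hε1 : ε ≤ 1 / 10 := by
    rw [hε, div_le_div_iff₀ (by positivity) (by norm_num)]; linarith
  have hε' : 0 < 1 - ε := by linarith
  set m := ⌈Real.log κ⌉₊ + 1 with hm
  have hmlog : Real.log κ ≤ m := by
    rw [hm]; push_cast; linarith [Nat.le_ceil (Real.log κ)]
  have hmle : (m : ℝ) ≤ Real.log κ + 2 := by
    rw [hm]; push_cast; linarith [Nat.ceil_lt_add_one (Real.log_pos hκ1).le]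
  have hm1 : (1 : ℝ) ≤ m := by rw [hm]; push_cast; linarith [Nat.cast_nonneg (α := ℝ) ⌈Real.log κ⌉₊]
  have hodds : ε / (1 - ε) ≤ 1 := by rw [div_le_one hε']; linarith
  have hs : √(ε / (1 - ε)) ≤ 1 := Real.sqrt_le_one.2 hodds
  have hs0 : 0 ≤ √(ε / (1 - ε)) := Real.sqrt_nonneg _
  refine le_trans (ENNReal.ofReal_le_ofReal (rate_le_of_le (m := m) (by omega)
    (Real.log_nonneg (by linarith [Real.sqrt_nonneg ((k : ℝ) / (n - k))]))
    (log_one_add_sqrt_le (q' := ε / (1 - ε)) ?_) (by linarith)))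
    (ofReal_le_minimaxRisk_of_moments hε0 (by linarith) (by omega) ?_ ?_
      (fewOutliers_of_sparse hk hkn.le le_rfl))
  · have h1 : ε ≤ ε / (1 - ε) := by rw [le_div_iff₀ hε']; nlinarith
    have h2 : (k : ℝ) / (n - k) ≤ 200 * ε := by
      rw [hε, div_le_iff₀ (by linarith)]
      have : 200 * ((k : ℝ) / (10 * n)) * (n - k) = k * (20 * (n - k)) / n := by
        field_simp; ring
      rw [this, le_div_iff₀ hn0]
      nlinarith
    linarith
  · have := Real.log_le_sub_one_of_pos (by linarith : 0 < 1 + √(ε / (1 - ε)))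
    linarith
  · have h1 : n * ε ^ 2 = κ / 100 := by rw [hε, hκ]; field_simp; norm_num
    have h2 : κ ≤ Real.exp (2 * m) := by
      rw [← Real.log_le_iff_le_exp (by linarith)]
      linarith
    rw [h1]
    nlinarith [Real.exp_pos (2 * (m : ℝ))]

/-- The lower bound when at most a twentieth of the coordinates is uncontaminated: a coordinate is
uncontaminated with probability `10 (n - k) / n`, and about `log n` moments are matched. -/
lemma rate_le_minimaxRisk_dense {n k : ℕ} (hkn : k < n) (hgap : 20 * (n - k) ≤ n) :
    ENNReal.ofReal (1 / 28800000 * (Real.log (1 + √((k : ℝ) / (n - k))) ^ 2 /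
      Real.log (1 + ((k : ℝ) / √n) ^ (2 / 3 : ℝ)) ^ (3 / 2 : ℝ))) ≤ minimaxRisk k n := by
  have hgap' : 20 * ((n : ℝ) - k) ≤ n := by
    have : ((20 * (n - k) : ℕ) : ℝ) ≤ ((n : ℕ) : ℝ) := by exact_mod_cast hgap
    push_cast [Nat.cast_sub hkn.le] at this
    exact this
  have hL1 : (1 : ℝ) ≤ n - k := by
    have : ((k + 1 : ℕ) : ℝ) ≤ n := by exact_mod_cast hkn
    push_cast at this
    linarith
  have hn20 : (20 : ℝ) ≤ n := by linarith
  have hn0 : (0 : ℝ) < n := by linarith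
  have hk0 : (0 : ℝ) ≤ k := Nat.cast_nonneg k
  have hksq : 9 / 10 * (n : ℝ) ≤ (k : ℝ) ^ 2 / n := by
    rw [le_div_iff₀ hn0]; nlinarith
  have hk2 : n ≤ k ^ 2 := by
    have : (n : ℝ) ≤ (k : ℝ) ^ 2 := by nlinarith
    exact_mod_cast this
  obtain ⟨hD, hlogκ⟩ := log_sq_div_le (by exact_mod_cast hn0) hk2
  have hlogn : Real.log n ≤ Real.log ((k : ℝ) ^ 2 / n) + 1 := by
    have h1 : (n : ℝ) ≤ (k : ℝ) ^ 2 / n * 2 := by linarith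
    have h2 := Real.log_le_log hn0 h1
    rw [Real.log_mul (by linarith) (by norm_num)] at h2
    linarith [Real.log_two_lt_d9]
  set p := 10 * ((n : ℝ) - k) / n with hp
  have hp0 : 0 < p := by positivity
  have hp2 : p ≤ 1 / 2 := by
    rw [hp, div_le_div_iff₀ hn0 (by norm_num)]; linarith
  have hpn : 10 ≤ p * n := by rw [hp, div_mul_cancel₀ _ hn0.ne']; linarith
  set m := ⌈Real.log n⌉₊ + 1 with hm
  have hmlog : Real.log n ≤ m := by
    rw [hm]; push_cast; linarith [Nat.le_ceil (Real.log n)]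
  have hmle : (m : ℝ) ≤ Real.log n + 2 := by
    rw [hm]; push_cast; linarith [Nat.ceil_lt_add_one (Real.log_nonneg (by linarith : 1 ≤ (n : ℝ)))]
  have hodds : (1 - p) / p ≤ n := by
    rw [div_le_iff₀ hp0]; linarith
  have hmoments := ofReal_le_minimaxRisk_of_moments (n := n) (k := k) (m := m) (ε := 1 - p)
    (by linarith) (by linarith) (by omega)
  rw [sub_sub_cancel] at hmoments
  refine le_trans (ENNReal.ofReal_le_ofReal (rate_le_of_le (m := m) (by omega)
    (Real.log_nonneg (by linarith [Real.sqrt_nonneg ((k : ℝ) / (n - k))]))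
    (log_one_add_sqrt_le (q' := (1 - p) / p) ?_) (by linarith)))
    (hmoments ?_ ?_ (fewOutliers_of_dense hkn le_rfl))
  · have h1 : (n : ℝ) / (20 * (n - k)) ≤ (1 - p) / p := by
      calc (n : ℝ) / (20 * (n - k)) = 1 / 2 / p := by rw [hp]; field_simp; norm_num
        _ ≤ (1 - p) / p := by gcongr; linarith
    have h2 : (k : ℝ) / (n - k) ≤ 20 * (n / (20 * (n - k))) := by
      have : 20 * ((n : ℝ) / (20 * (n - k))) = n / (n - k) := by field_simp
      rw [this]
      gcongr
    have h3 : 0 ≤ (1 - p) / p := div_nonneg (by linarith) hp0.le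
    linarith
  · refine le_trans (Real.log_le_log ?_ ?_) hmlog
    · linarith [Real.sqrt_nonneg ((1 - p) / p)]
    · have h1 : √((1 - p) / p) ≤ n - 1 := by
        rw [Real.sqrt_le_iff]
        exact ⟨by linarith, hodds.trans (by nlinarith)⟩
      linarith
  · have h1 : (n : ℝ) ≤ Real.exp m := (Real.log_le_iff_le_exp hn0).1 hmlog
    have h2 : Real.exp (2 * m) = Real.exp m * Real.exp m := by rw [← Real.exp_add]; congr 1; ring
    have h3 : (n : ℝ) * n ≤ Real.exp (2 * m) := by
      rw [h2]; exact mul_le_mul h1 h1 hn0.le (Real.exp_pos _).le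
    have h4 : (n : ℝ) * (1 - p) ^ 2 ≤ n := by
      refine mul_le_of_le_one_right hn0.le (pow_le_one₀ (by linarith) (by linarith))
    calc (n : ℝ) * (1 - p) ^ 2 ≤ 1 * n := by linarith
      _ ≤ p * n * n := by gcongr; linarith
      _ = p * (n * n) := by ring
      _ ≤ p * Real.exp (2 * m) := by gcongr

end GOSC

theorem mainTheorem1 :
    ∃ c : ℝ, 0 < c ∧ ∀ n k : ℕ, 0 < n → 1 ≤ k → k < n →
      ENNReal.ofReal
        (c * (Real.log (1 + ((k : ℝ) / ((n : ℝ) - (k : ℝ))) ^ (1 / 2 : ℝ)) ^ 2 /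
          Real.log (1 + ((k : ℝ) / Real.sqrt (n : ℝ)) ^ (2 / 3 : ℝ)) ^ (3 / 2 : ℝ)))
        ≤ GOSC.minimaxRisk k n := by
  refine ⟨1 / 28800000, by norm_num, fun n k _ hk hkn => ?_⟩
  rw [← Real.sqrt_eq_rpow]
  rcases le_or_gt (k ^ 2) n with h | h
  · exact (ENNReal.ofReal_le_ofReal (GOSC.rate_le_parametric hk hkn h)).trans
      (GOSC.ofReal_parametric_le_minimaxRisk hk hkn.le)
  · rcases lt_or_ge n (20 * (n - k)) with hgap | hgap
    · exact GOSC.rate_le_minimaxRisk_sparse hkn h hgap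
    · exact GOSC.rate_le_minimaxRisk_dense hkn hgap
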